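/- Let $\mathfrak g$ be a finite-dimensional real nilpotent Lie algebra of step $k\ge 2$, with descending central series $\mathfrak g_1=\mathfrak g$, $\mathfrak g_{j+1}=[\mathfrak g_j,\mathfrak g]$ (so $\mathfrak g_k\neq 0=\mathfrak g_{k+1}$). Let $G$ be the connected, simply connected Lie group with Lie algebra $\mathfrak g$, that is, $\mathfrak g$ with the Baker–Campbell–Hausdorff product, $\exp$ being the identity map, and let $\Gamma\subset G$ be a lattice (a discrete subgroup with $\Gamma\backslash G$ compact). A Malcev basis through the descending central series, strongly based at $\Gamma$, is an ordered basis $E^1_1,\dots,E^1_{n_1},\dots,E^k_1,\dots,E^k_{n_k}$ of $\mathfrak g$ such that: dropping its first $\ell$ elements leaves, for every $\ell$, a basis of a subalgebra; the vectors $E^i_m$ with $i\ge j$ form a basis of $\mathfrak g_j$ for $1\le j\le k$; and $\Gamma$ is the set of all ordered products $\exp(m^1_1E^1_1)\cdots\exp(m^k_{n_k}E^k_{n_k})$ with integers $m^j_i$. A vector of $\mathfrak g$ is rational if it lies in the $\mathbb Q$-span of such a basis. A subspace is rational if it has a basis of rational vectors. For $Z$ in the centre of $\mathfrak g$, the rational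 envelope $[Z]_\Gamma$ is the smallest rational subspace of the centre that contains $Z$. An element $X\in\mathfrak g$ is completely irrational if the coordinates of its projection to $\mathfrak g/[\mathfrak g,\mathfrak g]$, in a basis formed by projections of rational vectors, are linearly independent over $\mathbb Q$. Let $X\in\mathfrak g$ be completely irrational. Then there exist $Y,Z\in\mathfrak g$ with $[X,Y]=Z$ and $Z\in\mathfrak g_k$ (i.e. $(X,Y,Z)$ is a Heisenberg triple) such that $Z$ is completely irrational in $\mathfrak g_k$, in the sense that its rational envelope $[Z]_\Gamma$ exists and equals $\mathfrak g_k$. Moreover, let $(E^j_i)$ be any Malcev basis as above, let $\omega_1(X),\dots,\omega_{n_1}(X)$ be the coordinates of $X$ along $E^1_1,\dots,E^1_{n_1}$, and let $\mathbb K=\mathbb Q(\omega_1(X),\dots,\omega_{n_1}(X))$. Then there are real numbers $y_1,\dots,y_{n_{k-1}}$ that are algebraically independent over $\mathbb K$, and for every such choice $Y=\sum_j y_jE^{k-1}_j$ and $Z=[X,Y]$ have the properties above. -/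

import Mathlib

namespace Nilmanifold

variable {𝔤 : Type*} [LieRing 𝔤] [LieAlgebra ℝ 𝔤]

/-- The step of a nilpotent Lie algebra: the least `k` with `𝔤_{k+1} = 0`. -/
noncomputable def step (𝔤 : Type*) [LieRing 𝔤] : ℕ :=
  LieModule.nilpotencyLength 𝔤 𝔤

/-- The descending central series, numbered from one:
`𝔤_1 = 𝔤` and `𝔤_{j+1} = [𝔤, 𝔤_j]` (only `j ≥ 1` is used). -/
noncomputable def centralTerm (𝔤 : Type*) [LieRing 𝔤] [LieAlgebra ℝ 𝔤] (j : ℕ) : LieIdeal ℝ 𝔤 :=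
  LieModule.lowerCentralSeries ℝ 𝔤 𝔤 (j - 1)

/-! ### The simply connected group

The connected, simply connected nilpotent Lie group `G` with Lie algebra `𝔤` is realised in
exponential coordinates: its underlying space is `𝔤`, the exponential map is the identity, the
product is given by the Baker-Campbell-Hausdorff formula (a finite sum, as `𝔤` is nilpotent), the
identity element is `0` and the inverse of `x` is `-x`. -/

/-- The right-nested bracket `[w₁, [w₂, … [w_{d-1}, w_d] … ]]`. -/
def nestedBracket : List 𝔤 → 𝔤
  | [] => 0
  | [a] => a
  | a :: b :: l => ⁅a, nestedBracket (b :: l)⁆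

/-- Sequences `(r₁, s₁), …, (r_n, s_n)` of pairs of natural numbers with `r_i + s_i > 0` for all
`i` and `∑ (r_i + s_i) = d`. -/
def dynkinIndex (n d : ℕ) : Finset (Fin n → ℕ × ℕ) :=
  (Fintype.piFinset fun _ => Finset.range (d + 1) ×ˢ Finset.range (d + 1)).filter
    fun p => (∀ i, 0 < (p i).1 + (p i).2) ∧ ∑ i, ((p i).1 + (p i).2) = d

/-- The part of degree `d` of the Baker-Campbell-Hausdorff series, in Dynkin's form:
`∑_n (-1)^(n-1) / n ∑ [x^{r₁} y^{s₁} ⋯ x^{r_n} y^{s_n}] / (d ∏ r_i! s_i!)`. -/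
noncomputable def bchTerm (d : ℕ) (x y : 𝔤) : 𝔤 :=
  ∑ n ∈ Finset.Icc 1 d, ∑ p ∈ dynkinIndex n d,
    (((-1 : ℝ) ^ (n - 1) / n) *
        (1 / ((d : ℝ) * ∏ i, (((p i).1.factorial : ℝ) * ((p i).2.factorial : ℝ))))) •
      nestedBracket
        (List.ofFn fun i => List.replicate (p i).1 x ++ List.replicate (p i).2 y).flatten

/-- The product of `G` in exponential coordinates, `log (exp x · exp y)`. The terms of degree
larger than the step vanish. -/
noncomputable def bch (x y : 𝔤) : 𝔤 :=
  ∑ d ∈ Finset.Icc 1 (step 𝔤), bchTerm d x y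

/-- A lattice `Γ` in `G` (given by its image `log Γ` in exponential coordinates):
a discrete subgroup such that `Γ \ G` is compact. -/
structure IsLattice [TopologicalSpace 𝔤] (Γ : Set 𝔤) : Prop where
  one_mem : (0 : 𝔤) ∈ Γ
  mul_mem : ∀ x ∈ Γ, ∀ y ∈ Γ, bch x y ∈ Γ
  inv_mem : ∀ x ∈ Γ, -x ∈ Γ
  discrete : DiscreteTopology Γ
  cocompact : ∃ K : Set 𝔤, IsCompact K ∧ ∀ g : 𝔤, ∃ γ ∈ Γ, ∃ h ∈ K, g = bch γ h

/-! ### Malcev bases and the rational structure -/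

/-- A Malcev basis of `𝔤` through the descending central series and strongly based at `Γ`.
The basis is listed in order `E_0, …, E_{N-1}`, and `level i = j` means that `E_i` is one of the
vectors `E^j_1, …, E^j_{n_j}` of the `j`-th block. -/
structure MalcevBasis (Γ : Set 𝔤) where
  N : ℕ
  basis : Module.Basis (Fin N) ℝ 𝔤
  level : Fin N → ℕ
  level_mem : ∀ i, level i ∈ Finset.Icc 1 (step 𝔤)
  level_mono : Monotone level
  /-- Dropping the first `l` vectors leaves a basis of a subalgebra. -/
  subalgebra : ∀ l ≤ N, ∃ H : LieSubalgebra ℝ 𝔤,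
    H.toSubmodule = Submodule.span ℝ (basis '' {i | l ≤ (i : ℕ)})
  /-- The blocks from the `j`-th on form a basis of `𝔤_j`. -/
  central : ∀ j ∈ Finset.Icc 1 (step 𝔤),
    Submodule.span ℝ (basis '' {i | j ≤ level i}) = (centralTerm 𝔤 j).toSubmodule
  /-- `Γ` consists of the products `exp (m_0 E_0) ⋯ exp (m_{N-1} E_{N-1})` with integers `m_i`. -/
  strongly_based : Γ = Set.range fun m : Fin N → ℤ =>
    (List.ofFn fun i => (m i : ℝ) • basis i).foldr bch 0

/-- `V` is rational with respect to `Γ`: it lies in the `ℚ`-span of a Malcev basis strongly based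
at `Γ`. -/
def IsRational (Γ : Set 𝔤) (V : 𝔤) : Prop :=
  ∃ B : MalcevBasis Γ, ∃ q : Fin B.N → ℚ, V = ∑ i, (q i : ℝ) • B.basis i

/-- `V` is completely irrational with respect to the abelianized lattice: its projection to
`𝔤 / [𝔤, 𝔤]` has `ℚ`-linearly independent coordinates in a rational basis, that is, a basis
of `𝔤 / [𝔤, 𝔤]` made of projections of rational vectors. -/
def IsCompletelyIrrational (Γ : Set 𝔤) (V : 𝔤) : Prop :=
  ∃ (n : ℕ) (c : Module.Basis (Fin n) ℝ (𝔤 ⧸ (centralTerm 𝔤 2).toSubmodule)),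
    (∀ i, ∃ W : 𝔤, IsRational Γ W ∧ c i = (centralTerm 𝔤 2).toSubmodule.mkQ W) ∧
    LinearIndependent ℚ fun i => c.repr ((centralTerm 𝔤 2).toSubmodule.mkQ V) i

/-- A rational subspace: one that admits a basis of rational vectors. -/
def IsRationalSubspace (Γ : Set 𝔤) (W : Submodule ℝ 𝔤) : Prop :=
  ∃ (n : ℕ) (v : Fin n → 𝔤), (∀ i, IsRational Γ (v i)) ∧ LinearIndependent ℝ v ∧
    Submodule.span ℝ (Set.range v) = W

/-- `W` is the rational envelope of `Z`: the smallest rational subspace of the centre of `𝔤`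
that contains `Z`. -/
def IsRationalEnvelope (Γ : Set 𝔤) (Z : 𝔤) (W : Submodule ℝ 𝔤) : Prop :=
  IsLeast {U : Submodule ℝ 𝔤 | IsRationalSubspace Γ U ∧
    U ≤ (LieAlgebra.center ℝ 𝔤).toSubmodule ∧ Z ∈ U} W

/-- A Heisenberg triple: `[X, Y] = Z` and `Z` is in the last term `𝔤_k` of the central series. -/
def IsHeisenbergTriple (X Y Z : 𝔤) : Prop :=
  Z ∈ centralTerm 𝔤 (step 𝔤) ∧ ⁅X, Y⁆ = Z

/-- The field `ℚ(ω_1(X), …, ω_n(X))` generated by the coordinates of the projection of `X` to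
`𝔤 / [𝔤, 𝔤]` with respect to the first block of a Malcev basis. -/
noncomputable def frequencyField {Γ : Set 𝔤} (B : MalcevBasis Γ) (X : 𝔤) :
    IntermediateField ℚ ℝ :=
  IntermediateField.adjoin ℚ {r | ∃ i, B.level i = 1 ∧ r = B.basis.repr X i}

end Nilmanifold

/-!
Write `E_i` for the vectors of a Malcev basis `B` strongly based at `Γ`.

**Rational structure.** All Malcev bases strongly based at `Γ` have the same `ℚ`-span
(`mem_rationalPoints_of_isRational`). The point is that the structure constants of `B` are rational
(`lie_basis_mem_rationalPoints`). This is proved by descending induction on the total level `s` of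
`E_i` and `E_j`. For natural `t` the group commutator of `exp (t E_i)` and `exp (t E_j)` is an
element of `Γ` that lies in `𝔤_s`. It is an ordered product of powers of the `exp E_l` with `E_l` of
level at least `s`, whose brackets have total level at least `2 s > s`; so by induction it has
rational coordinates. On the other hand it is a polynomial in `t` whose coefficient of degree two
is `⁅E_i, E_j⁆`, and a polynomial with rational values at the natural numbers has rational
coefficients. Only the terms of degree at most two of the Baker-Campbell-Hausdorff formula enter;
neither associativity of the product nor a formula for conjugation is needed.

**Rational envelope.** Let `Y = ∑ y_j E^{k-1}_j` and `Z = ⁅X, Y⁆`, and suppose that a rational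
subspace `U` contains `Z` but not all of `𝔤_k`. Then a functional `φ` with rational coordinates
vanishes on `U` but not on `𝔤_k` (`exists_rational_functional`). From
`0 = φ Z = ∑ y_j φ ⁅X, E^{k-1}_j⁆`, in which the `φ ⁅X, E^{k-1}_j⁆` belong to the field generated
by the coordinates of `X`, independence of the `y_j` gives `φ ⁅X, E^{k-1}_j⁆ = 0` for all `j`. Now
`φ ⁅·, E^{k-1}_j⁆` is a rational functional on `𝔤 / [𝔤, 𝔤]`, so it is zero because `X` is completely
irrational (`eq_zero_of_isCompletelyIrrational`). Since the brackets `⁅v, E^{k-1}_j⁆` span `𝔤_k`,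
the functional `φ` vanishes on `𝔤_k` (`map_centralTerm_eq_zero`), a contradiction.

Algebraically independent `y_j` exist because the field of `X` is countable
(`exists_algebraicIndependent_of_countable`).
-/

namespace Nilmanifold

variable {𝔤 : Type*} [LieRing 𝔤] [LieAlgebra ℝ 𝔤]

/-! ### The Baker-Campbell-Hausdorff product in low degree -/

lemma nestedBracket_mem_ideal {I : LieIdeal ℝ 𝔤} {x y : 𝔤} (h : ⁅x, y⁆ ∈ I) (l : List 𝔤)
    (hl : ∀ a ∈ l, a = x ∨ a = y) (h2 : 2 ≤ l.length) : nestedBracket l ∈ I := by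
  induction l with
  | nil => simp at h2
  | cons a l ih =>
    match l, ih, hl, h2 with
    | [b], _, hl, _ =>
      have h' : ⁅y, x⁆ ∈ I := by rw [← lie_skew]; exact I.neg_mem h
      rcases hl a (by simp) with rfl | rfl <;> rcases hl b (by simp) with rfl | rfl <;>
        simp [nestedBracket, h, h']
    | b :: c :: l, ih, hl, _ =>
      exact I.lie_mem (ih (fun a ha => hl a (List.mem_cons_of_mem _ ha)) (by simp))

/-- The word `x^{r₁} y^{s₁} ⋯ x^{r_n} y^{s_n}` of an index of Dynkin's formula. -/
abbrev dynkinWord {α : Type*} {n : ℕ} (p : Fin n → ℕ × ℕ) (x y : α) : List α :=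
  (List.ofFn fun i => List.replicate (p i).1 x ++ List.replicate (p i).2 y).flatten

lemma eq_or_eq_of_mem_dynkinWord {α : Type*} {n : ℕ} {p : Fin n → ℕ × ℕ} {x y a : α}
    (ha : a ∈ dynkinWord p x y) : a = x ∨ a = y := by
  simp only [dynkinWord, List.mem_flatten, List.mem_ofFn] at ha
  obtain ⟨_, ⟨i, rfl⟩, ha⟩ := ha
  rw [List.mem_append] at ha
  exact ha.imp List.eq_of_mem_replicate List.eq_of_mem_replicate

lemma length_dynkinWord {α : Type*} {n d : ℕ} {p : Fin n → ℕ × ℕ} (hp : p ∈ dynkinIndex n d)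
    (x y : α) : (dynkinWord p x y).length = d := by
  have := (Finset.mem_filter.1 hp).2.2
  simpa [dynkinWord, List.length_flatten, List.map_ofFn, Function.comp_def, List.sum_ofFn]

lemma map_dynkinWord {α β : Type*} {n : ℕ} (p : Fin n → ℕ × ℕ) (x y : α) (f : α → β) :
    (dynkinWord p x y).map f = dynkinWord p (f x) (f y) := by
  simp [dynkinWord, List.map_flatten, List.map_ofFn, Function.comp_def]

lemma bchTerm_one (x y : 𝔤) : bchTerm 1 x y = x + y := by
  have h : dynkinIndex 1 1 = {fun _ => (1, 0), fun _ => (0, 1)} := by decide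
  have hne : (fun _ => (1, 0) : Fin 1 → ℕ × ℕ) ∉ ({fun _ => (0, 1)} : Finset _) := by decide
  simp [bchTerm, h, Finset.sum_insert hne, nestedBracket]

lemma bchTerm_two (x y : 𝔤) : bchTerm 2 x y = (1 / 2 : ℝ) • ⁅x, y⁆ := by
  have h1 : dynkinIndex 1 2 = {fun _ => (2, 0), fun _ => (1, 1), fun _ => (0, 2)} := by decide
  have h2 : dynkinIndex 2 2 = {![(1, 0), (1, 0)], ![(1, 0), (0, 1)], ![(0, 1), (1, 0)],
      ![(0, 1), (0, 1)]} := by decide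
  have hI : Finset.Icc 1 2 = {1, 2} := by decide
  rw [bchTerm, hI, Finset.sum_pair (by decide), h1, h2]
  rw [Finset.sum_insert (by decide), Finset.sum_insert (by decide), Finset.sum_singleton,
    Finset.sum_insert (by decide), Finset.sum_insert (by decide), Finset.sum_insert (by decide),
    Finset.sum_singleton]
  have hs : ⁅y, x⁆ = -⁅x, y⁆ := (lie_skew y x).symm
  simp [nestedBracket, List.ofFn_succ, List.replicate_succ, hs, -lie_skew]

/-- Modulo an ideal containing `⁅x, y⁆` the product of `G` is addition. -/
lemma bch_sub_add_mem {I : LieIdeal ℝ 𝔤} {x y : 𝔤} (h : ⁅x, y⁆ ∈ I) (hk : 1 ≤ step 𝔤) :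
    bch x y - (x + y) ∈ I := by
  rw [bch, ← Finset.add_sum_Ioc_eq_sum_Icc hk, bchTerm_one, add_sub_cancel_left]
  refine sum_mem fun d hd => sum_mem fun n _ => sum_mem fun p hp => I.smul_mem _ ?_
  refine nestedBracket_mem_ideal h _ (fun a ha => eq_or_eq_of_mem_dynkinWord ha) ?_
  have := Finset.mem_Ioc.1 hd
  exact (length_dynkinWord hp x y).ge.trans' this.1

lemma bch_eq_add {x y : 𝔤} (h : ⁅x, y⁆ = 0) (hk : 1 ≤ step 𝔤) : bch x y = x + y := by
  have := bch_sub_add_mem (I := ⊥) (x := x) (y := y) (by simp [h]) hk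
  rwa [LieSubmodule.mem_bot, sub_eq_zero] at this

/-- An additive subgroup closed under rational multiples and brackets is closed under the product
of `G`, since the coefficients of Dynkin's formula are rational. -/
lemma bch_mem_of_lie_mem {S : AddSubgroup 𝔤} (hq : ∀ (q : ℚ), ∀ v ∈ S, (q : ℝ) • v ∈ S)
    (hlie : ∀ v ∈ S, ∀ w ∈ S, ⁅v, w⁆ ∈ S) {x y : 𝔤} (hx : x ∈ S) (hy : y ∈ S) :
    bch x y ∈ S := by
  have hnest : ∀ l : List 𝔤, (∀ a ∈ l, a ∈ S) → nestedBracket l ∈ S := by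
    intro l hl
    induction l with
    | nil => exact S.zero_mem
    | cons a l ih =>
      match l, ih, hl with
      | [], _, hl => exact hl a (by simp)
      | b :: l, ih, hl =>
        exact hlie _ (hl a (by simp)) _ (ih fun c hc => hl c (List.mem_cons_of_mem _ hc))
  refine sum_mem fun d _ => sum_mem fun n _ => sum_mem fun p _ => ?_
  have := hq ((((-1 : ℚ) ^ (n - 1) / n) *
        (1 / ((d : ℚ) * ∏ i, (((p i).1.factorial : ℚ) * ((p i).2.factorial : ℚ))))))
    _ (hnest (dynkinWord p x y) fun a ha => ?_)
  · push_cast at this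
    exact this
  · rcases eq_or_eq_of_mem_dynkinWord ha with rfl | rfl <;> assumption

/-! ### Polynomial curves -/

/-- The polynomial maps `ℝ → 𝔤` that vanish at `0` to order at least `m`. -/
def polyCurve (𝔤 : Type*) [LieRing 𝔤] [LieAlgebra ℝ 𝔤] (m : ℕ) : Submodule ℝ (ℝ → 𝔤) :=
  Submodule.span ℝ {f | ∃ d, m ≤ d ∧ ∃ c : 𝔤, f = fun t => t ^ d • c}

lemma polyCurve_antitone : Antitone (polyCurve 𝔤) := fun _ _ h =>
  Submodule.span_mono fun _ ⟨d, hd, c, hf⟩ => ⟨d, h.trans hd, c, hf⟩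

lemma smul_mem_polyCurve (d : ℕ) (c : 𝔤) : (fun t : ℝ => t ^ d • c) ∈ polyCurve 𝔤 d :=
  Submodule.subset_span ⟨d, le_rfl, c, rfl⟩

lemma lie_mem_polyCurve {m n : ℕ} {f g : ℝ → 𝔤} (hf : f ∈ polyCurve 𝔤 m)
    (hg : g ∈ polyCurve 𝔤 n) : (fun t => ⁅f t, g t⁆) ∈ polyCurve 𝔤 (m + n) := by
  induction hf using Submodule.span_induction with
  | zero =>
    convert (polyCurve 𝔤 (m + n)).zero_mem using 1
    ext t; simp
  | add f f' _ _ h h' => simpa using! add_mem h h'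
  | smul a f _ h => simpa using! Submodule.smul_mem _ a h
  | mem f hf =>
    obtain ⟨d, hd, c, rfl⟩ := hf
    induction hg using Submodule.span_induction with
    | zero =>
      convert (polyCurve 𝔤 (m + n)).zero_mem using 1
      ext t; simp
    | add f f' _ _ h h' => simpa using! add_mem h h'
    | smul a f _ h => simpa using! Submodule.smul_mem _ a h
    | mem g hg =>
      obtain ⟨e, he, c', rfl⟩ := hg
      refine Submodule.subset_span ⟨d + e, by omega, ⁅c, c'⁆, ?_⟩
      ext t
      simp [smul_smul, pow_add, mul_comm]

lemma nestedBracket_mem_polyCurve (l : List (ℝ → 𝔤)) (hl : ∀ f ∈ l, f ∈ polyCurve 𝔤 1) :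
    (fun t => nestedBracket (l.map fun f => f t)) ∈ polyCurve 𝔤 l.length := by
  induction l with
  | nil => exact (polyCurve 𝔤 0).zero_mem
  | cons f l ih =>
    match l, ih, hl with
    | [], _, hl => exact hl f (by simp)
    | g :: l, ih, hl =>
      have := lie_mem_polyCurve (hl f (by simp)) (ih fun c hc => hl c (List.mem_cons_of_mem _ hc))
      rw [add_comm] at this
      exact this

/-- For curves through the origin, the product of `G` is given up to order three by the terms of
degree one and two of the Baker-Campbell-Hausdorff formula. -/
lemma bch_mem_polyCurve (hk : 2 ≤ step 𝔤) {f g : ℝ → 𝔤} (hf : f ∈ polyCurve 𝔤 1)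
    (hg : g ∈ polyCurve 𝔤 1) :
    (fun t => bch (f t) (g t) - (f t + g t + (1 / 2 : ℝ) • ⁅f t, g t⁆)) ∈ polyCurve 𝔤 3 := by
  have key : (fun t => bch (f t) (g t) - (f t + g t + (1 / 2 : ℝ) • ⁅f t, g t⁆)) =
      ∑ d ∈ Finset.Ioc 2 (step 𝔤), fun t => bchTerm d (f t) (g t) := by
    ext t
    rw [bch, ← Finset.add_sum_Ioc_eq_sum_Icc (by omega), bchTerm_one,
      ← Finset.Icc_add_one_left_eq_Ioc, ← Finset.add_sum_Ioc_eq_sum_Icc (by omega)]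
    simp [bchTerm_two, ← add_assoc]
  rw [key]
  refine sum_mem fun d hd => ?_
  have key2 : (fun t => bchTerm d (f t) (g t)) = ∑ n ∈ Finset.Icc 1 d, ∑ p ∈ dynkinIndex n d,
    (((-1 : ℝ) ^ (n - 1) / n) *
        (1 / ((d : ℝ) * ∏ i, (((p i).1.factorial : ℝ) * ((p i).2.factorial : ℝ))))) •
      fun t => nestedBracket ((dynkinWord p f g).map fun f => f t) := by
    ext t
    simp only [Finset.sum_apply, Pi.smul_apply, map_dynkinWord]
    rfl
  rw [key2]
  refine sum_mem fun n _ => sum_mem fun p hp => Submodule.smul_mem _ _ ?_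
  refine polyCurve_antitone ?_ (nestedBracket_mem_polyCurve (dynkinWord p f g) fun a ha => ?_)
  · rw [length_dynkinWord hp]
    exact (Finset.mem_Ioc.1 hd).1
  · rcases eq_or_eq_of_mem_dynkinWord ha with rfl | rfl <;> assumption

/-- The product `x y x⁻¹ y⁻¹` in `G`. -/
noncomputable def groupCommutator (x y : 𝔤) : 𝔤 := bch (bch (bch x y) (-x)) (-y)

/-- The group commutator agrees with the Lie bracket up to order three. -/
lemma groupCommutator_mem_polyCurve (hk : 2 ≤ step 𝔤) (x y : 𝔤) :
    (fun t : ℝ => groupCommutator (t • x) (t • y) - t ^ 2 • ⁅x, y⁆) ∈ polyCurve 𝔤 3 := by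
  obtain ⟨f, hf⟩ : ∃ f : ℝ → 𝔤, ∀ t, f t = t • x := ⟨_, fun _ => rfl⟩
  obtain ⟨g, hg⟩ : ∃ g : ℝ → 𝔤, ∀ t, g t = t • y := ⟨_, fun _ => rfl⟩
  obtain ⟨p, hp⟩ : ∃ p : ℝ → 𝔤, ∀ t, p t = bch (f t) (g t) := ⟨_, fun _ => rfl⟩
  obtain ⟨r, hr⟩ : ∃ r : ℝ → 𝔤, ∀ t, r t = bch (p t) (-f t) := ⟨_, fun _ => rfl⟩
  have hf1 : f ∈ polyCurve 𝔤 1 := by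
    simpa only [pow_one, ← hf] using smul_mem_polyCurve 1 x
  have hg1 : g ∈ polyCurve 𝔤 1 := by
    simpa only [pow_one, ← hg] using smul_mem_polyCurve 1 y
  have mono {m n : ℕ} (h : m ≤ n) {f : ℝ → 𝔤} (hf : f ∈ polyCurve 𝔤 n) : f ∈ polyCurve 𝔤 m :=
    polyCurve_antitone h hf
  have hfg := lie_mem_polyCurve hf1 hg1
  have hskew (t : ℝ) : ⁅g t, f t⁆ = -⁅f t, g t⁆ := (lie_skew _ _).symm
  -- `p = f + g + ⁅f, g⁆ / 2` up to order three
  have h1 := bch_mem_polyCurve hk hf1 hg1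
  simp only [← hp] at h1
  have hp2 : p - (f + g) ∈ polyCurve 𝔤 2 := by
    convert add_mem (mono (show 2 ≤ 3 by omega) h1) (Submodule.smul_mem _ (1 / 2 : ℝ) hfg)
      using 1
    ext t
    simp only [Pi.add_apply, Pi.smul_apply, Pi.sub_apply]
    abel
  have hp1 : p ∈ polyCurve 𝔤 1 := by
    simpa only [sub_add_cancel] using
      add_mem (mono (show 1 ≤ 2 by omega) hp2) (add_mem hf1 hg1)
  -- `r = g + ⁅f, g⁆` up to order three
  have h2 := bch_mem_polyCurve hk hp1 (neg_mem hf1)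
  simp only [Pi.neg_apply, ← hr] at h2
  have hpf := lie_mem_polyCurve hp2 hf1
  have hr3 : (fun t => r t - (g t + ⁅f t, g t⁆)) ∈ polyCurve 𝔤 3 := by
    convert add_mem (add_mem h1 h2)
      (Submodule.smul_mem _ (-1 / 2 : ℝ) hpf) using 1
    ext t
    simp only [Pi.add_apply, Pi.smul_apply, Pi.sub_apply, sub_lie, add_lie, lie_neg,
      lie_self, hskew]
    module
  have hr2 : r - g ∈ polyCurve 𝔤 2 := by
    convert add_mem (mono (show 2 ≤ 3 by omega) hr3) hfg using 1
    ext t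
    simp only [Pi.add_apply, Pi.sub_apply]
    abel
  have hr1 : r ∈ polyCurve 𝔤 1 := by
    simpa only [sub_add_cancel] using add_mem (mono (show 1 ≤ 2 by omega) hr2) hg1
  have h3 := bch_mem_polyCurve hk hr1 (neg_mem hg1)
  simp only [Pi.neg_apply] at h3
  have hrg := lie_mem_polyCurve hr2 hg1
  have hsum := add_mem (add_mem h3 hr3) (Submodule.smul_mem _ (-1 / 2 : ℝ) hrg)
  refine Set.mem_of_eq_of_mem (funext fun t => ?_) hsum
  have hb : t ^ 2 • ⁅x, y⁆ = ⁅f t, g t⁆ := by simp [hf, hg, smul_smul, pow_two]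
  rw [hb]
  simp only [Pi.add_apply, Pi.smul_apply, Pi.sub_apply, sub_lie, lie_neg,
    lie_self, groupCommutator, ← hf, ← hg, ← hp, ← hr]
  module

/-- The commutator of `x` and `y` in `G` lies in every ideal containing `⁅x, y⁆`. -/
lemma groupCommutator_mem {I : LieIdeal ℝ 𝔤} {x y : 𝔤} (h : ⁅x, y⁆ ∈ I) (hk : 1 ≤ step 𝔤) :
    groupCommutator x y ∈ I := by
  have h' : ⁅y, x⁆ ∈ I := by rw [← lie_skew]; exact I.neg_mem h
  have h1 := bch_sub_add_mem h hk
  have h2 := bch_sub_add_mem (I := I) (x := bch x y) (y := -x) (by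
    have := lie_mem_left ℝ 𝔤 I _ x h1
    simp only [sub_lie, add_lie, lie_self, zero_add] at this
    simpa using I.neg_mem (add_mem this h')) hk
  have h12 : bch (bch x y) (-x) - y ∈ I := by
    convert add_mem h1 h2 using 1
    abel
  have h3 := bch_sub_add_mem (I := I) (x := bch (bch x y) (-x)) (y := -y) (by
    have := lie_mem_left ℝ 𝔤 I _ y h12
    simp only [sub_lie, lie_self, sub_zero] at this
    rw [lie_neg]
    exact I.neg_mem this) hk
  convert add_mem h12 h3 using 1
  rw [groupCommutator]
  abel

open Polynomial in
/-- The coordinates of a polynomial curve are polynomials. -/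
lemma exists_polynomial_of_mem_polyCurve {m : ℕ} {f : ℝ → 𝔤} (hf : f ∈ polyCurve 𝔤 m)
    (φ : 𝔤 →ₗ[ℝ] ℝ) :
    ∃ p : ℝ[X], (∀ d < m, p.coeff d = 0) ∧ ∀ t, φ (f t) = p.eval t := by
  induction hf using Submodule.span_induction with
  | zero => exact ⟨0, by simp⟩
  | add f g _ _ hf hg =>
    obtain ⟨p, hp, hp'⟩ := hf
    obtain ⟨q, hq, hq'⟩ := hg
    exact ⟨p + q, fun d hd => by simp [hp d hd, hq d hd], fun t => by simp [hp', hq']⟩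
  | smul a f _ hf =>
    obtain ⟨p, hp, hp'⟩ := hf
    exact ⟨C a * p, fun d hd => by simp [hp d hd], fun t => by simp [hp']⟩
  | mem f hf =>
    obtain ⟨e, he, c, rfl⟩ := hf
    refine ⟨C (φ c) * X ^ e, fun d hd => ?_, fun t => by simp [mul_comm (φ c)]⟩
    rw [coeff_C_mul_X_pow, if_neg (by omega)]

/-! ### Real polynomials with rational values -/

/-- The rational numbers as a subfield of `ℝ`. -/
noncomputable abbrev ratField : Subfield ℝ := (algebraMap ℚ ℝ).fieldRange

lemma ratCast_mem_ratField (q : ℚ) : (q : ℝ) ∈ ratField := ⟨q, rfl⟩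

open Polynomial in
/-- Lagrange interpolation at natural numbers: a real polynomial that maps `ℕ` into a subfield has
its coefficients there. -/
lemma coeff_mem_of_eval_mem {F : Subfield ℝ} {p : ℝ[X]} (h : ∀ n : ℕ, p.eval (n : ℝ) ∈ F)
    (d : ℕ) : p.coeff d ∈ F := by
  let s := Finset.range (p.natDegree + 1)
  let q : F[X] := Lagrange.interpolate s (fun n : ℕ => (n : F)) fun n => ⟨p.eval (n : ℝ), h n⟩
  have hinj : Set.InjOn (fun n : ℕ => (n : F)) s := Nat.cast_injective.injOn
  have hq : q.map F.subtype = p := by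
    refine eq_of_degrees_lt_of_eval_index_eq s (v := fun n : ℕ => (n : ℝ))
      Nat.cast_injective.injOn ?_ ?_ fun n hn => ?_
    · exact (degree_map_le).trans_lt (Lagrange.degree_interpolate_lt _ hinj)
    · rw [Finset.card_range]
      exact degree_le_natDegree.trans_lt (by exact_mod_cast Nat.lt_succ_self _)
    · have h1 : q.eval (n : F) = ⟨p.eval (n : ℝ), h n⟩ :=
        Lagrange.eval_interpolate_at_node _ hinj hn
      have h2 := congrArg F.subtype h1
      rw [← eval_map_apply] at h2
      simpa using h2
  rw [← hq, coeff_map]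
  exact (q.coeff d).2

/-! ### The central series -/

lemma centralTerm_antitone : Antitone (centralTerm 𝔤) := fun _ _ h =>
  LieModule.antitone_lowerCentralSeries ℝ 𝔤 𝔤 (Nat.sub_le_sub_right h 1)

lemma centralTerm_one : centralTerm 𝔤 1 = ⊤ := rfl

lemma lie_mem_lowerCentralSeries (p q : ℕ) {x y : 𝔤}
    (hx : x ∈ LieModule.lowerCentralSeries ℝ 𝔤 𝔤 p)
    (hy : y ∈ LieModule.lowerCentralSeries ℝ 𝔤 𝔤 q) :
    ⁅x, y⁆ ∈ LieModule.lowerCentralSeries ℝ 𝔤 𝔤 (p + q + 1) := by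
  induction p generalizing q x y with
  | zero =>
    rw [zero_add, LieModule.lowerCentralSeries_succ]
    exact LieSubmodule.lie_mem_lie (LieSubmodule.mem_top _) hy
  | succ p ih =>
    rw [LieModule.lowerCentralSeries_succ, ← LieSubmodule.mem_toSubmodule,
      LieSubmodule.lieIdeal_oper_eq_linear_span'] at hx
    induction hx using Submodule.span_induction with
    | zero => simp
    | add a b _ _ ha hb => rw [add_lie]; exact add_mem ha hb
    | smul c a _ ha => rw [smul_lie]; exact SMulMemClass.smul_mem _ ha
    | mem a ha =>
      obtain ⟨u, -, v, hv, rfl⟩ := ha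
      rw [lie_lie]
      refine sub_mem ?_ ?_
      · have : p + 1 + q + 1 = (p + q + 1) + 1 := by ring
        rw [this, LieModule.lowerCentralSeries_succ]
        exact LieSubmodule.lie_mem_lie (LieSubmodule.mem_top _) (ih q hv hy)
      · have h1 : ⁅u, y⁆ ∈ LieModule.lowerCentralSeries ℝ 𝔤 𝔤 (q + 1) := by
          rw [LieModule.lowerCentralSeries_succ]
          exact LieSubmodule.lie_mem_lie (LieSubmodule.mem_top _) hy
        have h2 := ih (q + 1) hv h1
        rwa [show p + (q + 1) + 1 = p + 1 + q + 1 by ring] at h2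

lemma lie_mem_centralTerm {p q : ℕ} (hp : 1 ≤ p) (hq : 1 ≤ q) {x y : 𝔤}
    (hx : x ∈ centralTerm 𝔤 p) (hy : y ∈ centralTerm 𝔤 q) : ⁅x, y⁆ ∈ centralTerm 𝔤 (p + q) := by
  have := lie_mem_lowerCentralSeries _ _ hx hy
  rwa [show p - 1 + (q - 1) + 1 = p + q - 1 by omega] at this

lemma centralTerm_eq_bot (hk : 1 ≤ step 𝔤) {j : ℕ} (hj : step 𝔤 < j) : centralTerm 𝔤 j = ⊥ := by
  obtain ⟨k, hk'⟩ := Nat.exists_eq_add_of_le' hk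
  have := ((LieModule.nilpotencyLength_eq_succ_iff ℝ 𝔤 𝔤 k).1 hk').1
  refine le_bot_iff.1 ((centralTerm_antitone hj).trans ?_)
  rw [hk', ← this]
  rfl

lemma bch_mem_ideal {I : LieIdeal ℝ 𝔤} (hk : 1 ≤ step 𝔤) {x y : 𝔤} (hx : x ∈ I) (hy : y ∈ I) :
    bch x y ∈ I := by
  simpa only [sub_add_cancel] using
    add_mem (bch_sub_add_mem (I := I) (x := x) (I.lie_mem hy) hk) (add_mem hx hy)

/-! ### Malcev bases and rational points -/

namespace MalcevBasis

variable {Γ : Set 𝔤} (B : MalcevBasis Γ)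

lemma one_le_step (i : Fin B.N) : 1 ≤ step 𝔤 := by
  have := Finset.mem_Icc.1 (B.level_mem i)
  omega

lemma one_le_level (i : Fin B.N) : 1 ≤ B.level i := (Finset.mem_Icc.1 (B.level_mem i)).1

lemma basis_mem_centralTerm {i : Fin B.N} {j : ℕ} (hj : 1 ≤ j) (h : j ≤ B.level i) :
    B.basis i ∈ centralTerm 𝔤 j := by
  have := Finset.mem_Icc.1 (B.level_mem i)
  rw [← LieSubmodule.mem_toSubmodule, ← B.central j (Finset.mem_Icc.2 ⟨hj, h.trans this.2⟩)]
  exact Submodule.subset_span ⟨i, h, rfl⟩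

/-- Elements of the `j`-th term of the central series have no coordinates of level below `j`. -/
lemma repr_eq_zero {v : 𝔤} {j : ℕ} (hv : v ∈ centralTerm 𝔤 j) {i : Fin B.N}
    (hi : B.level i < j) : B.basis.repr v i = 0 := by
  have hl := Finset.mem_Icc.1 (B.level_mem i)
  by_cases hj : j ≤ step 𝔤
  · rw [← LieSubmodule.mem_toSubmodule, ← B.central j (Finset.mem_Icc.2 ⟨by omega, hj⟩),
      Module.Basis.mem_span_image] at hv
    by_contra hne
    have : j ≤ B.level i := hv (Finsupp.mem_support_iff.2 hne)
    omega
  · rw [centralTerm_eq_bot (by omega) (not_le.1 hj), LieSubmodule.mem_bot] at hv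
    simp [hv]

/-- The vectors of `𝔤` with rational coordinates in a Malcev basis. -/
def rationalPoints : AddSubgroup 𝔤 where
  carrier := {v | ∀ i, B.basis.repr v i ∈ ratField}
  add_mem' hv hw i := by simpa using add_mem (hv i) (hw i)
  zero_mem' i := by simp
  neg_mem' hv i := by simpa using neg_mem (hv i)

lemma smul_mem_rationalPoints {a : ℝ} (ha : a ∈ ratField) {v : 𝔤} (hv : v ∈ B.rationalPoints) :
    a • v ∈ B.rationalPoints := fun i => by
  simpa using mul_mem ha (hv i)

lemma basis_mem_rationalPoints (i : Fin B.N) : B.basis i ∈ B.rationalPoints := fun j => by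
  rw [B.basis.repr_self, Finsupp.single_apply]
  split_ifs
  exacts [one_mem _, zero_mem _]

lemma lie_mem_rationalPoints {v w : 𝔤} (hv : v ∈ B.rationalPoints) (hw : w ∈ B.rationalPoints)
    (h : ∀ i j, B.basis.repr v i ≠ 0 → B.basis.repr w j ≠ 0 →
      ⁅B.basis i, B.basis j⁆ ∈ B.rationalPoints) : ⁅v, w⁆ ∈ B.rationalPoints := by
  rw [← B.basis.sum_repr v, ← B.basis.sum_repr w]
  simp only [sum_lie, lie_sum]
  refine sum_mem fun j _ => sum_mem fun i _ => ?_
  rw [smul_lie, lie_smul]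
  by_cases hi : B.basis.repr v i = 0
  · simp [hi]
  by_cases hj : B.basis.repr w j = 0
  · simp [hj]
  exact B.smul_mem_rationalPoints (hv i) (B.smul_mem_rationalPoints (hw j) (h i j hi hj))

/-! ### Ordered products -/

/-- The product in `G` of the elements `exp (m_i E_i)`, for `i` in a list of indices. -/
noncomputable def word (m : Fin B.N → ℤ) (l : List (Fin B.N)) : 𝔤 :=
  (l.map fun i => (m i : ℝ) • B.basis i).foldr bch 0

@[simp]
lemma word_nil (m : Fin B.N → ℤ) : B.word m [] = 0 := rfl

lemma word_cons (m : Fin B.N → ℤ) (i : Fin B.N) (l : List (Fin B.N)) :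
    B.word m (i :: l) = bch ((m i : ℝ) • B.basis i) (B.word m l) := rfl

lemma word_cons_of_eq_zero {m : Fin B.N → ℤ} {i : Fin B.N} (h : m i = 0) (l : List (Fin B.N)) :
    B.word m (i :: l) = B.word m l := by
  rw [word_cons, h, bch_eq_add (by simp) (B.one_le_step i)]
  simp

lemma mem_iff_exists_word {v : 𝔤} : v ∈ Γ ↔ ∃ m, B.word m (List.finRange B.N) = v := by
  refine (Set.ext_iff.1 B.strongly_based v).trans ?_
  simp only [Set.mem_range, List.ofFn_eq_map]
  rfl

lemma word_mem_centralTerm (m : Fin B.N → ℤ) {s : ℕ} (hs : 1 ≤ s) (l : List (Fin B.N))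
    (hl : ∀ i ∈ l, s ≤ B.level i) : B.word m l ∈ centralTerm 𝔤 s := by
  induction l with
  | nil => simp
  | cons i l ih =>
    rw [word_cons]
    exact bch_mem_ideal (B.one_le_step i)
      (SMulMemClass.smul_mem _ (B.basis_mem_centralTerm hs (hl i (by simp))))
      (ih fun j hj => hl j (List.mem_cons_of_mem _ hj))

/-- The first factor of an ordered product splits off additively, up to deeper terms. -/
lemma word_cons_sub_mem (m : Fin B.N → ℤ) {i : Fin B.N} {l : List (Fin B.N)}
    (hl : ∀ j ∈ l, i < j) :
    B.word m (i :: l) - ((m i : ℝ) • B.basis i + B.word m l) ∈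
      centralTerm 𝔤 (B.level i + 1) := by
  have h1 := B.one_le_level i
  refine bch_sub_add_mem ?_ (B.one_le_step i)
  rw [add_comm]
  refine lie_mem_centralTerm le_rfl h1 ?_
    (B.word_mem_centralTerm m h1 l fun j hj => B.level_mono (hl j hj).le)
  rw [centralTerm_one]
  exact LieSubmodule.mem_top _

lemma repr_word_eq_zero (m : Fin B.N → ℤ) {i : Fin B.N} {l : List (Fin B.N)}
    (hs : l.Pairwise (· < ·)) (hl : ∀ j ∈ l, i < j) : B.basis.repr (B.word m l) i = 0 := by
  induction l with
  | nil => simp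
  | cons j l ih =>
    obtain ⟨hj, hs⟩ := List.pairwise_cons.1 hs
    have hij : i < j := hl j (by simp)
    have h := B.repr_eq_zero (B.word_cons_sub_mem m hj)
      (Nat.lt_succ_of_le (B.level_mono hij.le))
    simpa [ih hs fun a ha => hl a (List.mem_cons_of_mem _ ha), Finsupp.single_apply, hij.ne',
      sub_eq_zero] using h

/-- An ordered product in the `s`-th term of the central series has no factor of level below
`s`. -/
lemma eq_zero_of_word_mem (m : Fin B.N → ℤ) {s : ℕ} {l : List (Fin B.N)}
    (hs : l.Pairwise (· < ·)) (hw : B.word m l ∈ centralTerm 𝔤 s) :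
    ∀ i ∈ l, B.level i < s → m i = 0 := by
  induction l with
  | nil => simp
  | cons j l ih =>
    obtain ⟨hj, hs⟩ := List.pairwise_cons.1 hs
    by_cases hjs : B.level j < s
    · have h := B.repr_eq_zero (B.word_cons_sub_mem m hj) (Nat.lt_succ_self _)
      have hm : m j = 0 := by
        simpa [B.repr_word_eq_zero m hs hj, B.repr_eq_zero hw hjs] using h
      rw [B.word_cons_of_eq_zero hm] at hw
      intro i hi his
      rcases List.mem_cons.1 hi with rfl | hi
      · exact hm
      · exact ih hs hw i hi his
    · intro i hi his
      have : B.level j ≤ B.level i := by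
        rcases List.mem_cons.1 hi with rfl | hi
        exacts [le_rfl, B.level_mono (hj i hi).le]
      omega

/-- With a single nonzero exponent `n` at `i` the ordered product is `exp (n E_i)`. -/
lemma word_single (i : Fin B.N) (n : ℤ) {l : List (Fin B.N)} (hl : l.Nodup) :
    B.word (Pi.single i n) l = if i ∈ l then (n : ℝ) • B.basis i else 0 := by
  induction l with
  | nil => simp
  | cons j l ih =>
    obtain ⟨hj, hl⟩ := List.nodup_cons.1 hl
    by_cases hij : j = i
    · subst hij
      rw [word_cons, ih hl, if_neg hj, bch_eq_add (by simp) (B.one_le_step j)]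
      simp
    · rw [B.word_cons_of_eq_zero (by simp [hij]), ih hl]
      simp [Ne.symm hij]

lemma smul_basis_mem (i : Fin B.N) (n : ℤ) : (n : ℝ) • B.basis i ∈ Γ :=
  B.mem_iff_exists_word.2 ⟨Pi.single i n, by
    rw [B.word_single i n (List.nodup_finRange _), if_pos (List.mem_finRange i)]⟩

lemma basis_mem (i : Fin B.N) : B.basis i ∈ Γ := by simpa using B.smul_basis_mem i 1

/-! ### Rational structure constants -/

/-- If the brackets of basis vectors of total level above `s` are rational, then so are the
elements of `Γ` in the `s`-th term of the central series. -/
lemma mem_rationalPoints_of_mem_centralTerm {s : ℕ} (hs : 1 ≤ s)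
    (h : ∀ i j, s + 1 ≤ B.level i + B.level j → ⁅B.basis i, B.basis j⁆ ∈ B.rationalPoints)
    {γ : 𝔤} (hγ : γ ∈ Γ) (hγs : γ ∈ centralTerm 𝔤 s) : γ ∈ B.rationalPoints := by
  obtain ⟨m, rfl⟩ := B.mem_iff_exists_word.1 hγ
  have hm := B.eq_zero_of_word_mem m (List.pairwise_lt_finRange _) hγs
  let S : AddSubgroup 𝔤 := B.rationalPoints ⊓ (centralTerm 𝔤 s).toSubmodule.toAddSubgroup
  have hS : ∀ v ∈ S, ∀ w ∈ S, ⁅v, w⁆ ∈ S := fun v hv w hw => by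
    -- only basis vectors of level at least `s` occur, of total level at least `2 s > s`
    refine ⟨B.lie_mem_rationalPoints hv.1 hw.1 fun i j hi hj => h i j ?_,
      LieSubmodule.lie_mem _ hw.2⟩
    have hi' : s ≤ B.level i := not_lt.1 fun hlt => hi (B.repr_eq_zero hv.2 hlt)
    have hj' : s ≤ B.level j := not_lt.1 fun hlt => hj (B.repr_eq_zero hw.2 hlt)
    omega
  suffices ∀ l : List (Fin B.N), B.word m l ∈ S from (this _).1
  intro l
  induction l with
  | nil => exact S.zero_mem
  | cons i l ih =>
    by_cases his : B.level i < s
    · rwa [B.word_cons_of_eq_zero (hm i (List.mem_finRange i) his)]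
    · refine bch_mem_of_lie_mem (fun q v hv => ?_) hS ?_ ih
      · exact ⟨B.smul_mem_rationalPoints (ratCast_mem_ratField q) hv.1,
          (centralTerm 𝔤 s).smul_mem _ hv.2⟩
      · exact ⟨B.smul_mem_rationalPoints (by simp) (B.basis_mem_rationalPoints i),
          (centralTerm 𝔤 s).smul_mem _ (B.basis_mem_centralTerm hs (not_lt.1 his))⟩

/-- The structure constants of a Malcev basis are rational. By descending induction on the total
level `s` of `E_i` and `E_j`: the commutator of `exp (t E_i)` and `exp (t E_j)` is, for natural
`t`, an element of `Γ` in the `s`-th term of the central series, hence rational, and it is a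
polynomial in `t` with `⁅E_i, E_j⁆` as its coefficient of degree two. -/
lemma lie_basis_mem_rationalPoints (hΓ : ∀ x ∈ Γ, ∀ y ∈ Γ, bch x y ∈ Γ) (hΓ' : ∀ x ∈ Γ, -x ∈ Γ)
    (hk : 2 ≤ step 𝔤) (i j : Fin B.N) : ⁅B.basis i, B.basis j⁆ ∈ B.rationalPoints := by
  suffices ∀ d i j, step 𝔤 + 1 ≤ B.level i + B.level j + d →
      ⁅B.basis i, B.basis j⁆ ∈ B.rationalPoints from this (step 𝔤 + 1) i j (by omega)
  intro d
  induction d with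
  | zero =>
    intro i j hij
    have h0 := lie_mem_centralTerm (B.one_le_level i) (B.one_le_level j)
      (B.basis_mem_centralTerm (B.one_le_level i) le_rfl)
      (B.basis_mem_centralTerm (B.one_le_level j) le_rfl)
    rw [centralTerm_eq_bot (by omega) (by omega), LieSubmodule.mem_bot] at h0
    rw [h0]
    exact zero_mem _
  | succ d ih =>
    intro i j hij a
    have hi := B.one_le_level i
    have hj := B.one_le_level j
    have hlie (t : ℝ) : ⁅t • B.basis i, t • B.basis j⁆ ∈
        centralTerm 𝔤 (B.level i + B.level j) :=
      lie_mem_centralTerm hi hj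
        (SMulMemClass.smul_mem _ (B.basis_mem_centralTerm hi le_rfl))
        (SMulMemClass.smul_mem _ (B.basis_mem_centralTerm hj le_rfl))
    have hrat (n : ℕ) : groupCommutator ((n : ℝ) • B.basis i) ((n : ℝ) • B.basis j) ∈
        B.rationalPoints := by
      refine B.mem_rationalPoints_of_mem_centralTerm (s := B.level i + B.level j) (by omega)
        (fun i' j' h => ih i' j' (by omega)) ?_ (groupCommutator_mem (hlie n) (by omega))
      have h1 : (n : ℝ) • B.basis i ∈ Γ := by simpa using B.smul_basis_mem i n
      have h2 : (n : ℝ) • B.basis j ∈ Γ := by simpa using B.smul_basis_mem j n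
      exact hΓ _ (hΓ _ (hΓ _ h1 _ h2) _ (hΓ' _ h1)) _ (hΓ' _ h2)
    obtain ⟨p, hp, hp'⟩ := exists_polynomial_of_mem_polyCurve
      (groupCommutator_mem_polyCurve hk (B.basis i) (B.basis j)) (B.basis.coord a)
    have hc := coeff_mem_of_eval_mem (F := ratField)
      (p := p + Polynomial.C (B.basis.repr ⁅B.basis i, B.basis j⁆ a) * Polynomial.X ^ 2)
      (fun n => by
        convert hrat n a using 1
        have := hp' n
        simp only [map_sub, map_smul, Module.Basis.coord_apply, smul_eq_mul] at this
        simp only [Polynomial.eval_add, ← this, Polynomial.eval_mul, Polynomial.eval_C,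
          Polynomial.eval_pow, Polynomial.eval_X]
        ring) 2
    simpa [hp 2 (by omega)] using hc

/-- All Malcev bases strongly based at `Γ` have the same rational span. -/
lemma mem_rationalPoints_of_isRational (hΓ : ∀ x ∈ Γ, ∀ y ∈ Γ, bch x y ∈ Γ)
    (hΓ' : ∀ x ∈ Γ, -x ∈ Γ) (hk : 2 ≤ step 𝔤) {v : 𝔤} (hv : IsRational Γ v) :
    v ∈ B.rationalPoints := by
  obtain ⟨B', q, rfl⟩ := hv
  refine sum_mem fun i _ => B.smul_mem_rationalPoints (ratCast_mem_ratField _) ?_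
  refine B.mem_rationalPoints_of_mem_centralTerm le_rfl
    (fun i j _ => B.lie_basis_mem_rationalPoints hΓ hΓ' hk i j) (B'.basis_mem i) ?_
  rw [centralTerm_one]
  exact LieSubmodule.mem_top _

end MalcevBasis

/-! ### Algebraically independent families -/

open Cardinal in
/-- There are arbitrarily large finite families of real numbers algebraically independent over a
countable subfield, as an algebraic extension of a countable field is countable. -/
lemma exists_algebraicIndependent_of_countable (K : IntermediateField ℚ ℝ) [Countable K]
    (ι : Type*) [Finite ι] : ∃ y : ι → ℝ, AlgebraicIndependent K y := by
  obtain ⟨s, hs⟩ := exists_isTranscendenceBasis K ℝ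
  have hinf : s.Infinite := by
    intro hfin
    have := hfin.countable.to_subtype
    have halg := hs.isAlgebraic_field
    have h1 := Algebra.IsAlgebraic.cardinalMk_le_max
      (IntermediateField.adjoin K (Set.range ((↑) : s → ℝ))) ℝ
    have h2 := IntermediateField.cardinalMk_adjoin_le K (Set.range ((↑) : s → ℝ))
    have h3 : #ℝ ≤ ℵ₀ := h1.trans (max_le (h2.trans (by simp)) le_rfl)
    rw [Cardinal.mk_real] at h3
    exact absurd h3 (not_le.2 Cardinal.aleph0_lt_continuum)
  have := hinf.to_subtype
  obtain ⟨n, ⟨e⟩⟩ := Finite.exists_equiv_fin ι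
  refine ⟨fun i => (Infinite.natEmbedding s (e i) : ℝ),
    hs.1.comp (fun i => Infinite.natEmbedding s (e i)) fun i j hij => ?_⟩
  exact e.injective (Fin.val_injective ((Infinite.natEmbedding s).injective hij))

/-! ### Rational functionals -/

namespace MalcevBasis

variable {Γ : Set 𝔤} (B : MalcevBasis Γ)

lemma map_mem_ratField {φ : 𝔤 →ₗ[ℝ] ℝ} (hφ : ∀ i, φ (B.basis i) ∈ ratField) {v : 𝔤}
    (hv : v ∈ B.rationalPoints) : φ v ∈ ratField := by
  rw [← B.basis.sum_repr v, map_sum]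
  refine sum_mem fun i _ => ?_
  rw [map_smul]
  exact mul_mem (hv i) (hφ i)

/-- A basis vector outside a subspace is separated, by a functional with rational coordinates,
from the rational points of that subspace. -/
lemma exists_rational_functional {U : Submodule ℝ 𝔤} {m : Fin B.N} (hm : B.basis m ∉ U) :
    ∃ φ : 𝔤 →ₗ[ℝ] ℝ, (∀ i, φ (B.basis i) ∈ ratField) ∧
      (∀ v ∈ B.rationalPoints, v ∈ U → φ v = 0) ∧ φ (B.basis m) ≠ 0 := by
  -- the rational points of `U`, in coordinates
  let V : Submodule ℚ (Fin B.N → ℚ) :=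
    { carrier := {q | ∑ i, (q i : ℝ) • B.basis i ∈ U}
      add_mem' := fun {p q} hp hq => by
        simpa [add_smul, Finset.sum_add_distrib] using U.add_mem hp hq
      zero_mem' := by simp
      smul_mem' := fun a q hq => by
        simpa [Finset.smul_sum, smul_smul] using U.smul_mem (a : ℝ) hq }
  have hmV : (Pi.single m 1 : Fin B.N → ℚ) ∉ V := fun h => hm (by
    have h : ∑ i, ((Pi.single m 1 : Fin B.N → ℚ) i : ℝ) • B.basis i ∈ U := h
    simpa [Pi.single_apply, apply_ite] using h)
  obtain ⟨f, hf, hfV⟩ := V.exists_le_ker_of_notMem hmV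
  refine ⟨B.basis.constr ℝ fun i => (f (Pi.single i 1) : ℝ), fun i => ?_, fun v hv hvU => ?_, ?_⟩
  · rw [Module.Basis.constr_basis]
    exact ratCast_mem_ratField _
  · choose q hq using hv
    have hq' : ∀ i, (q i : ℝ) = B.basis.repr v i := hq
    have hqV : q ∈ V := by
      change ∑ i, (q i : ℝ) • B.basis i ∈ U
      simpa [hq'] using hvU
    have h0 : f q = 0 := hfV hqV
    have hs (i : Fin B.N) : (fun j => if i = j then (1 : ℚ) else 0) = Pi.single i 1 := by
      ext j
      simp [Pi.single_apply, eq_comm]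
    rw [LinearMap.pi_apply_eq_sum_univ f q] at h0
    simp only [hs, smul_eq_mul] at h0
    rw [Module.Basis.constr_apply_fintype]
    simp only [Module.Basis.equivFun_apply, ← hq', smul_eq_mul]
    exact_mod_cast h0
  · rw [Module.Basis.constr_basis]
    exact_mod_cast hf

/-- Complete irrationality in terms of functionals: a rational functional on `𝔤 / [𝔤, 𝔤]` that
vanishes at a completely irrational vector is zero. -/
lemma eq_zero_of_isCompletelyIrrational (hrat : ∀ v, IsRational Γ v → v ∈ B.rationalPoints)
    {X : 𝔤} (hX : IsCompletelyIrrational Γ X) {φ : 𝔤 →ₗ[ℝ] ℝ}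
    (hφ : ∀ i, φ (B.basis i) ∈ ratField) (hφ2 : ∀ v ∈ centralTerm 𝔤 2, φ v = 0)
    (hφX : φ X = 0) : φ = 0 := by
  obtain ⟨n, c, hc, hli⟩ := hX
  choose W hW hcW using hc
  let ψ := (centralTerm 𝔤 2).toSubmodule.liftQ φ fun v hv => hφ2 v hv
  have hψ (v : 𝔤) : ψ ((centralTerm 𝔤 2).toSubmodule.mkQ v) = φ v :=
    Submodule.liftQ_apply _ _ _
  choose q hq using fun i => B.map_mem_ratField hφ (hrat _ (hW i))
  have hψc (i : Fin n) : ψ (c i) = q i := by rw [hcW, hψ, ← hq]; rfl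
  have h0 : ∑ i, q i • c.repr ((centralTerm 𝔤 2).toSubmodule.mkQ X) i = 0 := by
    rw [← hφX, ← hψ X]
    conv_rhs => rw [← c.sum_repr ((centralTerm 𝔤 2).toSubmodule.mkQ X), map_sum]
    refine Finset.sum_congr rfl fun i _ => ?_
    rw [map_smul, hψc, Rat.smul_def, smul_eq_mul, mul_comm]
  have hq0 := Fintype.linearIndependent_iff.1 hli q h0
  have hψ0 : ψ = 0 := c.ext fun i => by simp [hψc, hq0]
  ext v
  rw [← hψ, hψ0]
  rfl

/-- A functional with rational coordinates that vanishes at `⁅X, Y⁆` vanishes on all of `𝔤_k`, if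
`X` is completely irrational and the coordinates of `Y` are algebraically independent over the
field of `X`. Independence gives `φ ⁅X, E_j⁆ = 0` for each `E_j` of level `k - 1`, and
`φ ⁅·, E_j⁆` is a rational functional on `𝔤 / [𝔤, 𝔤]`. -/
lemma map_centralTerm_eq_zero (hrat : ∀ v, IsRational Γ v → v ∈ B.rationalPoints)
    (hlie : ∀ i j, ⁅B.basis i, B.basis j⁆ ∈ B.rationalPoints) (hk : 2 ≤ step 𝔤)
    {X : 𝔤} (hX : IsCompletelyIrrational Γ X) {y : {i // B.level i = step 𝔤 - 1} → ℝ}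
    (hy : AlgebraicIndependent (frequencyField B X) y) {φ : 𝔤 →ₗ[ℝ] ℝ}
    (hφ : ∀ i, φ (B.basis i) ∈ ratField) (hφZ : φ ⁅X, ∑ i, y i • B.basis i⁆ = 0) :
    ∀ z ∈ centralTerm 𝔤 (step 𝔤), φ z = 0 := by
  -- `φ ⁅·, E_j⁆`, which for `E_j` of level `k - 1` factors through `𝔤 / [𝔤, 𝔤]`
  let ρ (j : Fin B.N) : 𝔤 →ₗ[ℝ] ℝ :=
    { toFun := fun v => φ ⁅v, B.basis j⁆
      map_add' := by simp
      map_smul' := by simp }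
  have hρ (j i) : ρ j (B.basis i) ∈ ratField := B.map_mem_ratField hφ (hlie i j)
  have hρ2 (j) (hj : B.level j = step 𝔤 - 1) : ∀ v ∈ centralTerm 𝔤 2, ρ j v = 0 := by
    intro v hv
    have h := lie_mem_centralTerm (by omega) (B.one_le_level j) hv
      (B.basis_mem_centralTerm (B.one_le_level j) le_rfl)
    rw [centralTerm_eq_bot (by omega) (by omega), LieSubmodule.mem_bot] at h
    change φ ⁅v, B.basis j⁆ = 0
    rw [h, map_zero]
  have hρX (j) (hj : B.level j = step 𝔤 - 1) : ρ j X ∈ frequencyField B X := by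
    have hsum : ρ j X = ∑ i, B.basis.repr X i • ρ j (B.basis i) := by
      conv_lhs => rw [← B.basis.sum_repr X, map_sum]
      simp only [map_smul]
    rw [hsum]
    refine sum_mem fun i _ => ?_
    by_cases hi : B.level i = 1
    · refine mul_mem (IntermediateField.subset_adjoin _ _ ⟨i, hi, rfl⟩) ?_
      obtain ⟨q, hq⟩ := hρ j i
      rw [← hq]
      exact IntermediateField.algebraMap_mem _ q
    · have := B.one_le_level i
      rw [hρ2 j hj _ (B.basis_mem_centralTerm (by omega) (by omega)), smul_zero]
      exact zero_mem _
  have hρX0 (j) (hj : B.level j = step 𝔤 - 1) : ρ j X = 0 := by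
    have h := Fintype.linearIndependent_iff.1 hy.linearIndependent
      (fun j => ⟨ρ j X, hρX j j.2⟩) (by
        rw [← hφZ, lie_sum, map_sum]
        refine Finset.sum_congr rfl fun i _ => ?_
        rw [lie_smul, map_smul, smul_eq_mul, mul_comm]
        rfl) ⟨j, hj⟩
    exact congrArg Subtype.val h
  have hρ0 (j) (hj : B.level j = step 𝔤 - 1) : ρ j = 0 :=
    B.eq_zero_of_isCompletelyIrrational hrat hX (hρ j) (hρ2 j hj) (hρX0 j hj)
  intro z hz
  have hstep : step 𝔤 - 1 = step 𝔤 - 1 - 1 + 1 := by omega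
  rw [centralTerm, hstep, LieModule.lowerCentralSeries_succ, ← LieSubmodule.mem_toSubmodule,
    LieSubmodule.lieIdeal_oper_eq_linear_span'] at hz
  induction hz using Submodule.span_induction with
  | zero => exact map_zero φ
  | add a b _ _ ha hb => rw [map_add, ha, hb, add_zero]
  | smul c a _ ha => rw [map_smul, ha, smul_zero]
  | mem a ha =>
    obtain ⟨u, -, v, hv, rfl⟩ := ha
    rw [← B.basis.sum_repr v, lie_sum, map_sum]
    refine Finset.sum_eq_zero fun j _ => ?_
    rw [lie_smul, map_smul]
    rcases lt_trichotomy (B.level j) (step 𝔤 - 1) with hj | hj | hj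
    · rw [B.repr_eq_zero (j := step 𝔤 - 1) hv hj, zero_smul]
    · have : φ ⁅u, B.basis j⁆ = 0 := LinearMap.congr_fun (hρ0 j hj) u
      rw [this, smul_zero]
    · have h := lie_mem_centralTerm le_rfl (B.one_le_level j)
        (show u ∈ centralTerm 𝔤 1 from LieSubmodule.mem_top _)
        (B.basis_mem_centralTerm (B.one_le_level j) le_rfl)
      rw [centralTerm_eq_bot (by omega) (by omega), LieSubmodule.mem_bot] at h
      rw [h, map_zero, smul_zero]

/-! ### The last term of the central series -/

lemma isRational_basis (i : Fin B.N) : IsRational Γ (B.basis i) :=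
  ⟨B, Pi.single i 1, by simp [Pi.single_apply, apply_ite]⟩

lemma isRationalSubspace_centralTerm (B : MalcevBasis Γ) (hk : 1 ≤ step 𝔤) :
    IsRationalSubspace Γ (centralTerm 𝔤 (step 𝔤)).toSubmodule := by
  let e := Fintype.equivFin {i // step 𝔤 ≤ B.level i}
  refine ⟨_, fun a => B.basis (e.symm a), fun a => B.isRational_basis _,
    B.basis.linearIndependent.comp _ (Subtype.val_injective.comp e.symm.injective), ?_⟩
  rw [← B.central _ (Finset.mem_Icc.2 ⟨hk, le_rfl⟩)]
  congr 1
  ext v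
  constructor
  · rintro ⟨a, rfl⟩
    exact ⟨_, (e.symm a).2, rfl⟩
  · rintro ⟨i, hi, rfl⟩
    exact ⟨e ⟨i, hi⟩, by simp⟩

end MalcevBasis

lemma centralTerm_step_le_center (hk : 1 ≤ step 𝔤) :
    (centralTerm 𝔤 (step 𝔤)).toSubmodule ≤ (LieAlgebra.center ℝ 𝔤).toSubmodule := by
  intro z hz
  rw [LieSubmodule.mem_toSubmodule, LieModule.mem_maxTrivSubmodule]
  intro u
  have h := lie_mem_centralTerm le_rfl hk
    (show u ∈ centralTerm 𝔤 1 from LieSubmodule.mem_top _) hz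
  rwa [centralTerm_eq_bot hk (by omega), LieSubmodule.mem_bot] at h

instance countable_frequencyField {Γ : Set 𝔤} (B : MalcevBasis Γ) (X : 𝔤) :
    Countable (frequencyField B X) := by
  rw [← Cardinal.mk_le_aleph0_iff]
  refine (IntermediateField.cardinalMk_adjoin_le _ _).trans ?_
  have : {r | ∃ i, B.level i = 1 ∧ r = B.basis.repr X i}.Countable :=
    (Set.countable_range fun i => B.basis.repr X i).mono
      (by rintro r ⟨i, -, hr⟩; exact ⟨i, hr.symm⟩)
  simp [Cardinal.le_aleph0_iff_set_countable.2 this]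

/-- A completely irrational vector comes with a Malcev basis: `𝔤 / [𝔤, 𝔤]` is nonzero, so that
there is a rational vector. -/
lemma IsCompletelyIrrational.nonempty_malcevBasis {Γ : Set 𝔤} {X : 𝔤}
    (hX : IsCompletelyIrrational Γ X) [LieRing.IsNilpotent 𝔤] [Nontrivial 𝔤] :
    Nonempty (MalcevBasis Γ) := by
  obtain ⟨n, c, hc, -⟩ := hX
  have hne : (centralTerm 𝔤 2).toSubmodule ≠ ⊤ := by
    intro h
    have h1 : LieModule.lowerCentralSeries ℝ 𝔤 𝔤 1 = ⊤ := by
      rwa [centralTerm, LieSubmodule.toSubmodule_eq_top] at h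
    have h2 (j : ℕ) : LieModule.lowerCentralSeries ℝ 𝔤 𝔤 j = ⊤ := by
      induction j with
      | zero => rfl
      | succ j ih =>
        rw [LieModule.lowerCentralSeries_succ, ih]
        exact h1
    obtain ⟨j, hj⟩ := LieModule.IsNilpotent.nilpotent ℝ 𝔤 𝔤
    exact bot_ne_top (hj.symm.trans (h2 j))
  have := Submodule.Quotient.nontrivial_iff.2 hne
  obtain ⟨i⟩ := c.index_nonempty
  obtain ⟨-, ⟨B, -⟩, -⟩ := hc i
  exact ⟨B⟩

end Nilmanifold

theorem mainTheorem7 {𝔤 : Type*} [LieRing 𝔤] [LieAlgebra ℝ 𝔤] [FiniteDimensional ℝ 𝔤]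
    [TopologicalSpace 𝔤] [IsTopologicalAddGroup 𝔤] [ContinuousSMul ℝ 𝔤] [T2Space 𝔤]
    [LieRing.IsNilpotent 𝔤] (k : ℕ) (hk : 2 ≤ k) (hstep : Nilmanifold.step 𝔤 = k)
    (Γ : Set 𝔤) (hΓ : Nilmanifold.IsLattice Γ)
    (X : 𝔤) (hX : Nilmanifold.IsCompletelyIrrational Γ X) :
    (∃ Y Z : 𝔤, Nilmanifold.IsHeisenbergTriple X Y Z ∧
      Nilmanifold.IsRationalEnvelope Γ Z (Nilmanifold.centralTerm 𝔤 k).toSubmodule) ∧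
    ∀ B : Nilmanifold.MalcevBasis Γ,
      (∃ y : {i // B.level i = k - 1} → ℝ,
        AlgebraicIndependent (Nilmanifold.frequencyField B X) y) ∧
      ∀ y : {i // B.level i = k - 1} → ℝ,
        AlgebraicIndependent (Nilmanifold.frequencyField B X) y →
        ∀ Y Z : 𝔤, Y = ∑ i, y i • B.basis i → Z = ⁅X, Y⁆ →
          Nilmanifold.IsHeisenbergTriple X Y Z ∧
          Nilmanifold.IsRationalEnvelope Γ Z (Nilmanifold.centralTerm 𝔤 k).toSubmodule := by
  open Nilmanifold in
  subst hstep
  have hk1 : 1 ≤ step 𝔤 := by omega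
  have main (B : MalcevBasis Γ) (y : {i // B.level i = step 𝔤 - 1} → ℝ)
      (hy : AlgebraicIndependent (frequencyField B X) y) (Y Z : 𝔤)
      (hY : Y = ∑ i, y i • B.basis i) (hZ : Z = ⁅X, Y⁆) :
      IsHeisenbergTriple X Y Z ∧
        IsRationalEnvelope Γ Z (centralTerm 𝔤 (step 𝔤)).toSubmodule := by
    subst hY hZ
    have hmem : ⁅X, ∑ i, y i • B.basis i⁆ ∈ centralTerm 𝔤 (step 𝔤) := by
      have hY : ∑ i, y i • B.basis i ∈ centralTerm 𝔤 (step 𝔤 - 1) :=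
        sum_mem fun i _ => SMulMemClass.smul_mem _ (B.basis_mem_centralTerm (by omega) i.2.ge)
      have h := lie_mem_centralTerm le_rfl (by omega)
        (show X ∈ centralTerm 𝔤 1 from LieSubmodule.mem_top _) hY
      rwa [show 1 + (step 𝔤 - 1) = step 𝔤 by omega] at h
    refine ⟨⟨hmem, rfl⟩, ⟨B.isRationalSubspace_centralTerm hk1,
      centralTerm_step_le_center hk1, hmem⟩, ?_⟩
    rintro U ⟨⟨n, v, hv, -, rfl⟩, -, hZU⟩
    have hrat (w : 𝔤) (hw : IsRational Γ w) : w ∈ B.rationalPoints :=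
      B.mem_rationalPoints_of_isRational hΓ.mul_mem hΓ.inv_mem hk hw
    rw [← B.central _ (Finset.mem_Icc.2 ⟨hk1, le_rfl⟩), Submodule.span_le]
    rintro _ ⟨m, hm, rfl⟩
    by_contra hmU
    obtain ⟨φ, hφ, hφU, hφm⟩ := B.exists_rational_functional hmU
    have hker : Submodule.span ℝ (Set.range v) ≤ LinearMap.ker φ :=
      Submodule.span_le.2 <| Set.range_subset_iff.2 fun i =>
        hφU _ (hrat _ (hv i)) (Submodule.subset_span ⟨i, rfl⟩)
    exact hφm (B.map_centralTerm_eq_zero hrat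
      (B.lie_basis_mem_rationalPoints hΓ.mul_mem hΓ.inv_mem hk) hk hX hy hφ (hker hZU) _
      (B.basis_mem_centralTerm hk1 hm))
  have hex (B : MalcevBasis Γ) : ∃ y : {i // B.level i = step 𝔤 - 1} → ℝ,
      AlgebraicIndependent (frequencyField B X) y :=
    exists_algebraicIndependent_of_countable _ _
  refine ⟨?_, fun B => ⟨hex B, main B⟩⟩
  have : Nontrivial 𝔤 := by
    by_contra h
    rw [not_nontrivial_iff_subsingleton] at h
    have := (LieModule.nilpotencyLength_eq_zero_iff 𝔤 𝔤).2 h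
    exact absurd (show step 𝔤 = 0 from this) (by omega)
  obtain ⟨B⟩ := hX.nonempty_malcevBasis
  obtain ⟨y, hy⟩ := hex B
  exact ⟨_, _, main B y hy _ _ rfl rfl⟩
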